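/- Let $B>0$, $N>0$, and let $K\ge 0$, $r\ge 1$ be integers. A receiver observes $$y(t)=\tilde\alpha\,s(t-\tilde\tau)+\alpha\,s(t-\tau)+n(t),$$ where $s:\mathbb R\to\mathbb C$ is a known signal, $\boldsymbol\tau=(\tilde\tau,\tau)\in\mathbb R^2$ and $\boldsymbol\alpha=(\tilde\alpha,\alpha)\in\mathbb C^2$ are the unknown delays and complex attenuations of the direct and the indirect path, and $n$ is a zero-mean circularly symmetric complex Gaussian process with autocorrelation $E[n(t_1)\overline{n(t_2)}]=2BN\,\mathrm{sinc}(2B(t_1-t_2))$, $\mathrm{sinc}(u)=\sin(\pi u)/(\pi u)$. The Nyquist-rate data are $\tilde{\mathbf y}\in\mathbb C^K$, $[\tilde{\mathbf y}]_p=y\big(\tfrac{p-1}{2B}\big)$ for $1\le p\le K$. The $r$-fold oversampled data $\mathbf y\in\mathbb C^{L}$, $L=rK$, are obtained from them by upsampling and ideal low-pass filtering: $$[\mathbf y]_l=\sum_{p=1}^{K}[\tilde{\mathbf y}]_p\,\mathrm{sinc}\Big(\frac{l-1}{r}-p+1\Big),\qquad 1\le l\le L .$$ For a known threshold vector $\boldsymbol\gamma\in\mathbb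 C^{L}$, the one-bit data are $\mathbf z=Q(\mathbf y)$, with $$[\mathbf z]_l=\tfrac1{\sqrt2}\,\mathrm{sgn}\,\mathrm{Re}([\mathbf y]_l-[\boldsymbol\gamma]_l)+\tfrac{j}{\sqrt2}\,\mathrm{sgn}\,\mathrm{Im}([\mathbf y]_l-[\boldsymbol\gamma]_l),\qquad \mathrm{sgn}\in\{1,-1\},\ \mathrm{sgn}(0)=1,$$ and $\tilde{\mathbf z}=Q(\tilde{\mathbf y})$ is the one-bit quantization of the Nyquist-rate data, the sample $[\tilde{\mathbf y}]_p=[\mathbf y]_{(p-1)r+1}$ being compared with the same threshold $[\boldsymbol\gamma]_{(p-1)r+1}$. For an observation $\mathbf x$ with likelihood $f(\mathbf x\mid\theta)$ with respect to some $\sigma$-finite dominating measure, let $\mathcal I(\mathbf x\mid\theta)=\big(E\big[\partial_{\theta_i}\log f\;\partial_{\theta_j}\log f\big]\big)_{i,j}$ denote its Fisher information matrix, here with respect to the real parameter vector $\theta=(\tilde\tau,\tau,\mathrm{Re}\,\tilde\alpha,\mathrm{Im}\,\tilde\alpha,\mathrm{Re}\,\alpha,\mathrm{Im}\,\alpha)$.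 Let $\theta$ be such that $s$ is differentiable at the points $\tfrac{p-1}{2B}-\tilde\tau$ and $\tfrac{p-1}{2B}-\tau$, $1\le p\le K$. Then the Fisher information matrices of $\mathbf y,\tilde{\mathbf y},\mathbf z,\tilde{\mathbf z}$ at $\theta$ exist, and 1. (full precision) $\mathcal I(\mathbf y\mid\boldsymbol\tau,\boldsymbol\alpha)=\mathcal I(\tilde{\mathbf y}\mid\boldsymbol\tau,\boldsymbol\alpha)$; 2. (one bit) $\mathcal I(\mathbf z\mid\boldsymbol\tau,\boldsymbol\alpha)\succeq\mathcal I(\tilde{\mathbf z}\mid\boldsymbol\tau,\boldsymbol\alpha)$, that is, the difference is symmetric positive semidefinite. -/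

import Mathlib

open MeasureTheory ProbabilityTheory Filter Topology

namespace OneBit

noncomputable section

/-! ### Fisher information matrices -/

section Fisher

/-- `f` is a family of densities (likelihood functions) `f(x | θ)`, with respect to the
dominating measure `ν`, of the statistical model `θ ↦ P θ`. -/
structure IsLikelihood {ι X : Type*} [MeasurableSpace X] (P : (ι → ℝ) → Measure X)
    (ν : Measure X) (f : (ι → ℝ) → X → ℝ) : Prop where
  sigmaFinite : SigmaFinite ν
  measurable : ∀ θ, Measurable (f θ)
  nonneg : ∀ θ x, 0 ≤ f θ x
  eq_withDensity : ∀ θ, P θ = ν.withDensity fun x => ENNReal.ofReal (f θ x)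

/-- `J` is the Fisher information matrix, at the parameter vector `θ`, of an observation whose
law under the parameter vector `θ'` is `P θ'`:  for some likelihood function `f(x | θ')` of the
model, almost every observation `x` has all partial derivatives `D i x = ∂ f(x | θ) / ∂ θ i`, the
scores `∂ log f(x | θ) / ∂ θ i = D i x / f θ x` are square integrable, and
`J i j = E [∂ log f(x | θ) / ∂ θ i * ∂ log f(x | θ) / ∂ θ j]`.

The dominating measure is arbitrary, so that continuous and discrete observations, and
observations carried by a proper subspace, are all covered.  The matrix does not depend on the
chosen likelihood function, see `IsFisherInformation.unique`. -/
def IsFisherInformation {ι X : Type*} [DecidableEq ι] [MeasurableSpace X]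
    (P : (ι → ℝ) → Measure X) (θ : ι → ℝ) (J : Matrix ι ι ℝ) : Prop :=
  ∃ (ν : Measure X) (f : (ι → ℝ) → X → ℝ) (D : ι → X → ℝ),
    IsLikelihood P ν f ∧
    (∀ i, ∀ᵐ x ∂(P θ), HasDerivAt (fun u => f (Function.update θ i u) x) (D i x) (θ i)) ∧
    (∀ i, MemLp (fun x => D i x / f θ x) 2 (P θ)) ∧
    ∀ i j, J i j = ∫ x, (D i x / f θ x) * (D j x / f θ x) ∂(P θ)

/-- The Fisher information exists: the model is regular enough at `θ`. -/
def HasFisherInformation {ι X : Type*} [DecidableEq ι] [MeasurableSpace X]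
    (P : (ι → ℝ) → Measure X) (θ : ι → ℝ) : Prop :=
  ∃ J, IsFisherInformation P θ J

open Classical in
/-- The Fisher information matrix of the model `P` at `θ` (zero if it does not exist). -/
def fisherInformation {ι X : Type*} [DecidableEq ι] [MeasurableSpace X]
    (P : (ι → ℝ) → Measure X) (θ : ι → ℝ) : Matrix ι ι ℝ :=
  if h : HasFisherInformation P θ then h.choose else 0

/-- Likelihood ratios do not depend on the choice of the likelihood function. -/
theorem IsLikelihood.ratio_eq {ι X : Type*} [MeasurableSpace X] {P : (ι → ℝ) → Measure X}
    {ν : Measure X} {f : (ι → ℝ) → X → ℝ} (h : IsLikelihood P ν f) (θ θ' : ι → ℝ) :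
    ∀ᵐ x ∂(P θ), f θ x ≠ 0 ∧ f θ' x / f θ x = ((P θ').rnDeriv (P θ) x).toReal := by
  have := h.sigmaFinite
  have hm := h.measurable θ
  have hm' := h.measurable θ'
  have hS : MeasurableSet {x | f θ x = 0} := hm (measurableSet_singleton 0)
  have h0 : (P θ) {x | f θ x = 0} = 0 := by
    rw [h.eq_withDensity θ, withDensity_apply _ hS, setLIntegral_eq_zero_iff hS (by fun_prop)]
    refine ae_of_all _ fun x hx => ?_
    rw [Set.mem_ofPred_eq] at hx
    simp [hx]
  have hpos : ∀ᵐ x ∂(P θ), f θ x ≠ 0 := by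
    rw [ae_iff]; simpa using h0
  have hsf : SigmaFinite (P θ) := by
    rw [h.eq_withDensity θ]; infer_instance
  have hsing : ((ν.restrict {x | f θ x = 0}).withDensity
      fun x => ENNReal.ofReal (f θ' x)) ⟂ₘ P θ := by
    refine ⟨{x | f θ x = 0}ᶜ, hS.compl, ?_, by simpa using h0⟩
    refine withDensity_absolutelyContinuous _ _ ?_
    rw [Measure.restrict_apply hS.compl]; simp
  have hadd : P θ' = ((ν.restrict {x | f θ x = 0}).withDensity
      fun x => ENNReal.ofReal (f θ' x)) +
      (P θ).withDensity fun x => ENNReal.ofReal (f θ' x / f θ x) := by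
    rw [h.eq_withDensity θ, h.eq_withDensity θ', ← withDensity_mul _ (by fun_prop) (by fun_prop),
      ← withDensity_indicator hS, ← withDensity_add_left
        (by exact Measurable.indicator (by fun_prop) hS)]
    congr 1
    funext x
    simp only [Pi.add_apply, Pi.mul_apply, Set.indicator_apply, Set.mem_ofPred_eq]
    by_cases hx : f θ x = 0
    · simp [hx]
    · rw [if_neg hx, zero_add, ← ENNReal.ofReal_mul (h.nonneg θ x), mul_div_cancel₀ _ hx]
  have key := Measure.eq_rnDeriv (ν := P θ) (by fun_prop) hsing hadd
  filter_upwards [hpos, key] with x hx hk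
  exact ⟨hx, by rw [← hk, ENNReal.toReal_ofReal (div_nonneg (h.nonneg _ _) (h.nonneg _ _))]⟩

/-- Two differentiable functions that agree along a sequence tending to `a` have the same
derivative at `a`. -/
theorem deriv_eq_of_eq_on_seq {g g' : ℝ → ℝ} {d d' a : ℝ} (hg : HasDerivAt g d a)
    (hg' : HasDerivAt g' d' a) (ha : g a = g' a)
    (hs : ∀ n : ℕ, g (a + 1 / ((n : ℝ) + 1)) = g' (a + 1 / ((n : ℝ) + 1))) : d = d' := by
  have hlim : Tendsto (fun n : ℕ => a + 1 / ((n : ℝ) + 1)) atTop (𝓝[≠] a) := by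
    refine tendsto_nhdsWithin_iff.2 ⟨?_, Eventually.of_forall fun n => ?_⟩
    · simpa using tendsto_one_div_add_atTop_nhds_zero_nat.const_add a
    · have : (0 : ℝ) < 1 / ((n : ℝ) + 1) := by positivity
      simp only [Set.mem_compl_iff, Set.mem_singleton_iff]
      linarith
  refine tendsto_nhds_unique ((hasDerivAt_iff_tendsto_slope.1 hg).comp hlim) ?_
  refine ((hasDerivAt_iff_tendsto_slope.1 hg').comp hlim).congr fun n => ?_
  simp only [Function.comp_apply, slope_def_field, hs n, ha]

/-- The Fisher information matrix is well defined. -/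
theorem IsFisherInformation.unique {ι X : Type*} [DecidableEq ι] [MeasurableSpace X]
    {P : (ι → ℝ) → Measure X} {θ : ι → ℝ} {J J' : Matrix ι ι ℝ}
    (h : IsFisherInformation P θ J) (h' : IsFisherInformation P θ J') : J = J' := by
  obtain ⟨ν, f, D, hf, hD, -, hJ⟩ := h
  obtain ⟨ν', f', D', hf', hD', -, hJ'⟩ := h'
  have key : ∀ i, ∀ᵐ x ∂(P θ), D i x / f θ x = D' i x / f' θ x := by
    intro i
    have hseq : ∀ᵐ x ∂(P θ), ∀ n : ℕ,
        f (Function.update θ i (θ i + 1 / ((n : ℝ) + 1))) x / f θ x =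
        f' (Function.update θ i (θ i + 1 / ((n : ℝ) + 1))) x / f' θ x := by
      rw [ae_all_iff]
      intro n
      filter_upwards [hf.ratio_eq θ (Function.update θ i (θ i + 1 / ((n : ℝ) + 1))),
        hf'.ratio_eq θ (Function.update θ i (θ i + 1 / ((n : ℝ) + 1)))] with x hx hx'
      rw [hx.2, hx'.2]
    filter_upwards [hseq, hD i, hD' i, hf.ratio_eq θ θ, hf'.ratio_eq θ θ] with x h1 h2 h3 h4 h5
    refine deriv_eq_of_eq_on_seq (h2.div_const (f θ x)) (h3.div_const (f' θ x)) ?_ h1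
    simp [div_self h4.1, div_self h5.1]
  ext i j
  rw [hJ, hJ']
  refine integral_congr_ae ?_
  filter_upwards [key i, key j] with x hi hj
  rw [hi, hj]

theorem IsFisherInformation.fisherInformation_eq {ι X : Type*} [DecidableEq ι]
    [MeasurableSpace X] {P : (ι → ℝ) → Measure X} {θ : ι → ℝ} {J : Matrix ι ι ℝ}
    (h : IsFisherInformation P θ J) : fisherInformation P θ = J := by
  have hex : HasFisherInformation P θ := ⟨J, h⟩
  rw [fisherInformation, dif_pos hex]
  exact hex.choose_spec.unique h

end Fisher

/-! ### The received signal -/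

/-- The normalized sinc function `sin (π u) / (π u)`, with value `1` at `u = 0`. -/
def nsinc (u : ℝ) : ℝ := Real.sinc (Real.pi * u)

/-- The filtered noise: a zero-mean circularly symmetric complex Gaussian process with
autocorrelation `2 B N sinc (2 B (t₁ - t₂))`, that is, white noise of power `N` after an ideal
low-pass filter of bandwidth `B`. -/
structure IsFilteredNoise {Ω : Type*} [MeasurableSpace Ω] (P : Measure Ω) (B N : ℝ)
    (n : ℝ → Ω → ℂ) : Prop where
  isGaussianProcess : IsGaussianProcess n P
  mean_zero : ∀ t, ∫ ω, n t ω ∂P = 0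
  autocorrelation : ∀ t₁ t₂, ∫ ω, n t₁ ω * (starRingEnd ℂ) (n t₂ ω) ∂P =
    ((2 * B * N * nsinc (2 * B * (t₁ - t₂)) : ℝ) : ℂ)
  circular : ∀ t₁ t₂, ∫ ω, n t₁ ω * n t₂ ω ∂P = 0

/-- The received signal `y(t) = α' s(t - τ') + α s(t - τ) + n(t)`, where `(τ', α')` are the delay
and the complex attenuation of the direct path, `(τ, α)` those of the indirect path.  The real
parameter vector is `θ = (τ', τ, Re α', Im α', Re α, Im α)`. -/
def received {Ω : Type*} (s : ℝ → ℂ) (n : ℝ → Ω → ℂ) (θ : Fin 6 → ℝ) (t : ℝ) (ω : Ω) : ℂ :=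
  (⟨θ 2, θ 3⟩ : ℂ) * s (t - θ 0) + (⟨θ 4, θ 5⟩ : ℂ) * s (t - θ 1) + n t ω

/-- The `p`-th Nyquist sampling instant `p / (2 B)` (indices start at `0`). -/
def nyquistTime (B : ℝ) {K : ℕ} (p : Fin K) : ℝ := (p : ℝ) / (2 * B)

/-- The `K` samples of the received signal at the Nyquist rate `2 B`. -/
def nyquistSamples {Ω : Type*} (s : ℝ → ℂ) (n : ℝ → Ω → ℂ) (B : ℝ) (K : ℕ) (θ : Fin 6 → ℝ)
    (ω : Ω) : Fin K → ℂ :=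
  fun p => received s n θ (nyquistTime B p) ω

/-- `r`-fold upsampling followed by the ideal low-pass filter with cutoff `π / r` and gain `r`:
the `l`-th output is `∑ p, y p * sinc (l / r - p)` (indices start at `0`). -/
def oversample (r : ℕ) {K : ℕ} (y : Fin K → ℂ) : Fin (r * K) → ℂ :=
  fun l => ∑ p : Fin K, y p * (nsinc ((l : ℝ) / r - (p : ℝ)) : ℂ)

/-- The position `r * p` of the `p`-th Nyquist sample among the oversampled data. -/
def nyquistIndex {r K : ℕ} (hr : 1 ≤ r) (p : Fin K) : Fin (r * K) :=
  ⟨r * p, Nat.mul_lt_mul_of_pos_left p.isLt hr⟩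

/-! ### One-bit quantization -/

/-- The sign, with values in `{1, -1}`. -/
def sgn (x : ℝ) : ℝ := if 0 ≤ x then 1 else -1

/-- The one-bit quantizer with threshold vector `γ`, acting on the real and imaginary parts of
each sample. -/
def quantize {L : ℕ} (γ y : Fin L → ℂ) : Fin L → ℂ :=
  fun l => ((1 / Real.sqrt 2 * sgn (y l - γ l).re : ℝ) : ℂ) +
    Complex.I * ((1 / Real.sqrt 2 * sgn (y l - γ l).im : ℝ) : ℂ)

end

end OneBit

/-! The noise samples taken at the Nyquist rate are uncorrelated, because `sinc` vanishes at the
nonzero integers, hence independent. So the real coordinates of the Nyquist data form a Gaussian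
location model, an exponential family whose natural parameter is the vector of noiseless samples:
densities and probabilities of all events are differentiable in the parameters as soon as the
noiseless samples are, which settles the existence of Fisher information, for one-bit data as finite
observations.

For the same reason the oversampled data contain the Nyquist data as entries. Thus oversampling is
injective and loses no information, and the one-bit Nyquist data are a function of the one-bit
oversampled data. For finite observations, the information lost by passing to a function is the mean
of the conditional covariance matrices of the scores, and so positive semidefinite. -/

namespace OneBit

section FisherInformation

variable {ι X Y : Type*} [MeasurableSpace X] [MeasurableSpace Y] {Q : (ι → ℝ) → Measure X}
  {θ : ι → ℝ}

theorem IsLikelihood.map_of_measurableEmbedding {ν : Measure X} {f : (ι → ℝ) → X → ℝ}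
    (hf : IsLikelihood Q ν f) {T : X → Y} (hT : MeasurableEmbedding T) :
    IsLikelihood (fun θ' => (Q θ').map T) (ν.map T) fun θ' => Function.extend T (f θ') 0 where
  sigmaFinite := have := hf.sigmaFinite; hT.sigmaFinite_map
  measurable θ' := hT.measurable_extend (hf.measurable θ') measurable_const
  nonneg θ' y := by
    by_cases hy : ∃ x, T x = y
    · obtain ⟨x, rfl⟩ := hy
      rw [hT.injective.extend_apply]
      exact hf.nonneg θ' x
    · simp [Function.extend_apply' _ _ _ hy]
  eq_withDensity θ' := by
    ext A hA
    rw [hf.eq_withDensity θ', hT.map_apply, withDensity_apply _ (hT.measurable hA),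
      withDensity_apply _ hA, hT.restrict_map, hT.lintegral_map]
    simp only [hT.injective.extend_apply]

variable [DecidableEq ι]

theorem IsFisherInformation.map_of_measurableEmbedding {J : Matrix ι ι ℝ}
    (h : IsFisherInformation Q θ J) {T : X → Y} (hT : MeasurableEmbedding T) :
    IsFisherInformation (fun θ' => (Q θ').map T) θ J := by
  obtain ⟨ν, f, D, hf, hD, hL, hJ⟩ := h
  refine ⟨ν.map T, fun θ' => Function.extend T (f θ') 0, fun i => Function.extend T (D i) 0,
    hf.map_of_measurableEmbedding hT, fun i => ?_, fun i => ?_, fun i j => ?_⟩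
  · simpa only [hT.ae_map_iff, hT.injective.extend_apply] using hD i
  · simpa only [hT.memLp_map_measure_iff, Function.comp_def, hT.injective.extend_apply] using hL i
  · simp only [hJ, hT.integral_map, hT.injective.extend_apply]

theorem HasFisherInformation.map_of_measurableEmbedding (h : HasFisherInformation Q θ)
    {T : X → Y} (hT : MeasurableEmbedding T) :
    HasFisherInformation (fun θ' => (Q θ').map T) θ :=
  let ⟨J, hJ⟩ := h
  ⟨J, hJ.map_of_measurableEmbedding hT⟩

theorem HasFisherInformation.fisherInformation_map_of_measurableEmbedding
    (h : HasFisherInformation Q θ) {T : X → Y} (hT : MeasurableEmbedding T) :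
    fisherInformation (fun θ' => (Q θ').map T) θ = fisherInformation Q θ := by
  obtain ⟨J, hJ⟩ := h
  rw [hJ.fisherInformation_eq, (hJ.map_of_measurableEmbedding hT).fisherInformation_eq]

/-- The regularity condition that every event has a probability with partial derivatives in all
parameters at `θ`. Unlike the existence of Fisher information, it passes to arbitrary functions of
the observation. -/
def EventwiseDifferentiableAt (Q : (ι → ℝ) → Measure X) (θ : ι → ℝ) : Prop :=
  ∀ i A, MeasurableSet A → DifferentiableAt ℝ (fun u => (Q (Function.update θ i u)).real A) (θ i)

theorem EventwiseDifferentiableAt.map (h : EventwiseDifferentiableAt Q θ) {T : X → Y}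
    (hT : Measurable T) : EventwiseDifferentiableAt (fun θ' => (Q θ').map T) θ := fun i A hA => by
  simp only [map_measureReal_apply hT hA]
  exact h i _ (hT hA)

end FisherInformation

section DiscreteObservation

variable {ι X Y : Type*}

/-- The Fisher information matrix of a discrete observation with values in the finite set `S`, in
terms of its point masses `p x` and their partial derivatives `d i x`. -/
noncomputable def discreteFisherMatrix (S : Finset X) (p : X → ℝ) (d : ι → X → ℝ) :
    Matrix ι ι ℝ :=
  .of fun i j => ∑ x ∈ S, d i x * d j x / p x

theorem sum_mul_score_sub_mul_score_sub {S : Finset X} {p a b : X → ℝ} (hp : ∀ x ∈ S, 0 ≤ p x)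
    (ha : ∀ x ∈ S, p x = 0 → a x = 0) (hb : ∀ x ∈ S, p x = 0 → b x = 0) :
    ∑ x ∈ S, p x * ((a x / p x - (∑ y ∈ S, a y) / ∑ y ∈ S, p y) *
        (b x / p x - (∑ y ∈ S, b y) / ∑ y ∈ S, p y)) =
      ∑ x ∈ S, a x * b x / p x - (∑ x ∈ S, a x) * (∑ x ∈ S, b x) / ∑ x ∈ S, p x := by
  set α := (∑ y ∈ S, a y) / ∑ y ∈ S, p y with hα
  set β := (∑ y ∈ S, b y) / ∑ y ∈ S, p y with hβ
  have hexpand : ∀ x ∈ S, p x * ((a x / p x - α) * (b x / p x - β)) =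
      a x * b x / p x - α * b x - a x * β + p x * (α * β) := fun x hx => by
    rcases eq_or_ne (p x) 0 with h0 | h0
    · simp [h0, ha x hx h0, hb x hx h0]
    · field_simp
      ring
  have hα_mul : (∑ x ∈ S, p x) * α = ∑ x ∈ S, a x := by
    refine mul_div_cancel_of_imp' fun h0 => Finset.sum_eq_zero fun x hx => ha x hx ?_
    exact (Finset.sum_eq_zero_iff_of_nonneg hp).1 h0 x hx
  rw [Finset.sum_congr rfl hexpand, Finset.sum_add_distrib, Finset.sum_sub_distrib,
    Finset.sum_sub_distrib, ← Finset.mul_sum, ← Finset.sum_mul, ← Finset.sum_mul, ← mul_assoc,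
    hα_mul, mul_div_assoc, ← hβ, hα]
  ring

-- The loss of information is the expected conditional covariance of the scores given `h`.
theorem discreteFisherMatrix_sub_fiberwise [DecidableEq Y] {S : Finset X} {p : X → ℝ}
    {d : ι → X → ℝ} (hp : ∀ x, 0 ≤ p x) (hd : ∀ i x, p x = 0 → d i x = 0) (h : X → Y) :
    discreteFisherMatrix S p d - discreteFisherMatrix (S.image h)
        (fun y => ∑ x ∈ S with h x = y, p x) (fun i y => ∑ x ∈ S with h x = y, d i x) =
      ∑ y ∈ S.image h, ∑ x ∈ S with h x = y, p x •
        let v := fun i => d i x / p x - (∑ x' ∈ S with h x' = y, d i x') /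
          ∑ x' ∈ S with h x' = y, p x'
        Matrix.vecMulVec v v := by
  ext i j
  simp only [discreteFisherMatrix, Matrix.sub_apply, Matrix.of_apply, Matrix.sum_apply,
    Matrix.smul_apply, Matrix.vecMulVec_apply, smul_eq_mul]
  rw [← Finset.sum_fiberwise_of_maps_to fun _ => Finset.mem_image_of_mem h,
    ← Finset.sum_sub_distrib]
  exact Finset.sum_congr rfl fun y _ => (sum_mul_score_sub_mul_score_sub (fun x _ => hp x)
    (fun x _ => hd i x) (fun x _ => hd j x)).symm

theorem posSemidef_discreteFisherMatrix_sub_fiberwise [Finite ι] [DecidableEq Y] {S : Finset X}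
    {p : X → ℝ} {d : ι → X → ℝ} (hp : ∀ x, 0 ≤ p x) (hd : ∀ i x, p x = 0 → d i x = 0)
    (h : X → Y) :
    (discreteFisherMatrix S p d - discreteFisherMatrix (S.image h)
      (fun y => ∑ x ∈ S with h x = y, p x)
      (fun i y => ∑ x ∈ S with h x = y, d i x)).PosSemidef := by
  rw [discreteFisherMatrix_sub_fiberwise hp hd h]
  exact Matrix.posSemidef_sum _ fun y _ => Matrix.posSemidef_sum _ fun x _ =>
    (Matrix.posSemidef_vecMulVec_self_star _).smul (hp x)

variable [MeasurableSpace X] [MeasurableSingletonClass X] {Q : (ι → ℝ) → Measure X}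
  {S : Finset X}

theorem memLp_of_ae_mem_finset {μ : Measure X} [IsFiniteMeasure μ] (hS : ∀ᵐ x ∂μ, x ∈ S)
    (f : X → ℝ) (q : ENNReal) : MemLp f q μ := by
  have hmeas : AEStronglyMeasurable f μ := by
    rw [← Measure.restrict_eq_self_of_ae_mem (s := (S : Set X)) hS]
    exact (IntegrableOn.finset (f := f)).aestronglyMeasurable
  refine .of_bound hmeas (∑ x ∈ S, ‖f x‖) ?_
  filter_upwards [hS] with x hx
  exact Finset.single_le_sum (f := fun x => ‖f x‖) (fun _ _ => norm_nonneg _) hx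

theorem integral_eq_sum_of_ae_mem_finset {μ : Measure X} [IsFiniteMeasure μ]
    (hS : ∀ᵐ x ∂μ, x ∈ S) (f : X → ℝ) : ∫ x, f x ∂μ = ∑ x ∈ S, μ.real {x} * f x := by
  conv_lhs => rw [← Measure.restrict_eq_self_of_ae_mem (s := (S : Set X)) hS]
  exact setIntegral_finset _ .finset

theorem isLikelihood_measureReal_singleton [∀ θ', IsFiniteMeasure (Q θ')]
    (hS : ∀ θ', ∀ᵐ x ∂Q θ', x ∈ S) :
    IsLikelihood Q (Measure.count.restrict S) fun θ' x => (Q θ').real {x} where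
  sigmaFinite :=
    have : IsFiniteMeasure (Measure.count.restrict (S : Set X)) := ⟨by simp⟩
    inferInstance
  measurable θ' := by
    refine measurable_const (a := (0 : ℝ)) |>.measurable_of_countable_ne
      (S.countable_toSet.mono fun x hx => ?_)
    by_contra hxS
    refine hx.symm ?_
    rw [measureReal_eq_zero_iff]
    exact measure_mono_null (by simpa using hxS) (hS θ')
  nonneg _ _ := measureReal_nonneg
  eq_withDensity θ' := by
    ext A hA
    calc Q θ' A = ∫⁻ x in S, A.indicator 1 x ∂Q θ' := by
          rw [Measure.restrict_eq_self_of_ae_mem (hS θ'), lintegral_indicator_one hA]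
      _ = ∫⁻ x in S, A.indicator (fun x => ENNReal.ofReal ((Q θ').real {x})) x
            ∂Measure.count := by
          rw [lintegral_finset, lintegral_finset]
          refine Finset.sum_congr rfl fun x _ => ?_
          by_cases hx : x ∈ A <;> simp [hx]
      _ = _ := by rw [lintegral_indicator hA, withDensity_apply _ hA]

variable [DecidableEq ι] {θ : ι → ℝ}

theorem EventwiseDifferentiableAt.hasDerivAt_measureReal_singleton
    (hQ : EventwiseDifferentiableAt Q θ) (i : ι) (x : X) :
    HasDerivAt (fun u => (Q (Function.update θ i u)).real {x})
      (deriv (fun u => (Q (Function.update θ i u)).real {x}) (θ i)) (θ i) :=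
  (hQ i _ (measurableSet_singleton x)).hasDerivAt

variable [∀ θ', IsFiniteMeasure (Q θ')]

theorem isFisherInformation_discreteFisherMatrix (hS : ∀ θ', ∀ᵐ x ∂Q θ', x ∈ S)
    {d : ι → X → ℝ}
    (hd : ∀ i x, HasDerivAt (fun u => (Q (Function.update θ i u)).real {x}) (d i x) (θ i)) :
    IsFisherInformation Q θ (discreteFisherMatrix S (fun x => (Q θ).real {x}) d) := by
  refine ⟨_, _, d, isLikelihood_measureReal_singleton hS, fun i => ae_of_all _ fun x => hd i x,
    fun i => memLp_of_ae_mem_finset (hS θ) _ 2, fun i j => ?_⟩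
  rw [integral_eq_sum_of_ae_mem_finset (hS θ), discreteFisherMatrix, Matrix.of_apply]
  refine Finset.sum_congr rfl fun x _ => ?_
  rcases eq_or_ne ((Q θ).real {x}) 0 with h0 | h0
  · simp [h0]
  · field_simp

theorem EventwiseDifferentiableAt.hasFisherInformation (hQ : EventwiseDifferentiableAt Q θ)
    (hS : ∀ θ', ∀ᵐ x ∂Q θ', x ∈ S) : HasFisherInformation Q θ :=
  ⟨_, isFisherInformation_discreteFisherMatrix hS hQ.hasDerivAt_measureReal_singleton⟩

theorem measureReal_map_singleton_eq_sum [DecidableEq Y] [MeasurableSpace Y]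
    [MeasurableSingletonClass Y] {μ : Measure X} [IsFiniteMeasure μ] (hS : ∀ᵐ x ∂μ, x ∈ S)
    {h : X → Y} (hh : Measurable h) (y : Y) :
    (μ.map h).real {y} = ∑ x ∈ S with h x = y, μ.real {x} := by
  rw [map_measureReal_apply hh (measurableSet_singleton y), sum_measureReal_singleton]
  refine measureReal_congr (eventuallyEq_set.2 ?_)
  filter_upwards [hS] with x hx
  simp [hx]

theorem EventwiseDifferentiableAt.posSemidef_fisherInformation_sub_map [Finite ι]
    [MeasurableSpace Y] [MeasurableSingletonClass Y] (hQ : EventwiseDifferentiableAt Q θ)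
    (hS : ∀ θ', ∀ᵐ x ∂Q θ', x ∈ S) {h : X → Y} (hh : Measurable h) :
    (fisherInformation Q θ - fisherInformation (fun θ' => (Q θ').map h) θ).PosSemidef := by
  classical
  have hS_map : ∀ θ', ∀ᵐ y ∂(Q θ').map h, y ∈ S.image h := fun θ' => by
    refine (ae_map_iff hh.aemeasurable (S.image h).measurableSet).2 ?_
    filter_upwards [hS θ'] with x hx using Finset.mem_image_of_mem h hx
  have hderiv_map : ∀ i y, HasDerivAt (fun u => ((Q (Function.update θ i u)).map h).real {y})
      (∑ x ∈ S with h x = y, deriv (fun u => (Q (Function.update θ i u)).real {x}) (θ i))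
      (θ i) := fun i y => by
    simp only [measureReal_map_singleton_eq_sum (hS _) hh]
    exact HasDerivAt.fun_sum fun x _ => hQ.hasDerivAt_measureReal_singleton i x
  have hderiv_zero : ∀ i x, (Q θ).real {x} = 0 →
      deriv (fun u => (Q (Function.update θ i u)).real {x}) (θ i) = 0 := fun i x h0 => by
    refine IsLocalMin.deriv_eq_zero (Eventually.of_forall fun u => ?_)
    simp only [Function.update_eq_self, h0, measureReal_nonneg]
  rw [(isFisherInformation_discreteFisherMatrix hS
      hQ.hasDerivAt_measureReal_singleton).fisherInformation_eq,
    (isFisherInformation_discreteFisherMatrix hS_map hderiv_map).fisherInformation_eq]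
  simp only [measureReal_map_singleton_eq_sum (hS θ) hh]
  exact posSemidef_discreteFisherMatrix_sub_fiberwise (fun _ => measureReal_nonneg) hderiv_zero h

end DiscreteObservation

section ExponentialFamily

variable {X E : Type*} [MeasurableSpace X] [NormedAddCommGroup E] [NormedSpace ℝ E]
  {μ : Measure X} {T : X → StrongDual ℝ E}

theorem integrable_exp_apply (hT : AEStronglyMeasurable T μ)
    (hexp : ∀ c : ℝ, Integrable (fun x => Real.exp (c * ‖T x‖)) μ) (η : E) :
    Integrable (fun x => Real.exp (T x η)) μ := by
  refine (hexp ‖η‖).mono'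
    (Real.continuous_exp.comp_aestronglyMeasurable (hT.apply_continuousLinearMap η))
    (ae_of_all _ fun x => ?_)
  rw [Real.norm_eq_abs, Real.abs_exp, Real.exp_le_exp, mul_comm]
  exact (le_abs_self _).trans ((T x).le_opNorm η)

theorem differentiable_integral_exp_apply (hT : AEStronglyMeasurable T μ)
    (hexp : ∀ c : ℝ, Integrable (fun x => Real.exp (c * ‖T x‖)) μ) :
    Differentiable ℝ fun η => ∫ x, Real.exp (T x η) ∂μ := fun η₀ => by
  have hbound : ∀ x, ∀ η ∈ Metric.ball η₀ 1,
      ‖Real.exp (T x η) • T x‖ ≤ Real.exp ((‖η₀‖ + 2) * ‖T x‖) := fun x η hη => by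
    have hη_norm : ‖η‖ ≤ ‖η₀‖ + 1 := by
      have := norm_sub_norm_le η η₀
      rw [mem_ball_iff_norm] at hη
      linarith
    calc ‖Real.exp (T x η) • T x‖ = Real.exp (T x η) * ‖T x‖ := by
          rw [norm_smul, Real.norm_eq_abs, Real.abs_exp]
      _ ≤ Real.exp ((‖η₀‖ + 1) * ‖T x‖) * Real.exp ‖T x‖ := by
          gcongr
          · calc T x η ≤ ‖T x‖ * ‖η‖ := (le_abs_self _).trans ((T x).le_opNorm η)
              _ ≤ (‖η₀‖ + 1) * ‖T x‖ := by rw [mul_comm]; gcongr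
          · linarith [Real.add_one_le_exp ‖T x‖]
      _ = Real.exp ((‖η₀‖ + 2) * ‖T x‖) := by rw [← Real.exp_add]; ring_nf
  exact (hasFDerivAt_integral_of_dominated_of_fderiv_le (Metric.ball_mem_nhds η₀ one_pos)
    (Eventually.of_forall fun η => (integrable_exp_apply hT hexp η).aestronglyMeasurable)
    (integrable_exp_apply hT hexp η₀)
    ((integrable_exp_apply hT hexp η₀).aestronglyMeasurable.smul hT) (ae_of_all _ hbound) (hexp _)
    (ae_of_all _ fun x η _ => (T x).hasFDerivAt.exp)).differentiableAt

theorem differentiable_measureReal_tilted [NeZero μ] (hT : AEStronglyMeasurable T μ)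
    (hexp : ∀ c : ℝ, Integrable (fun x => Real.exp (c * ‖T x‖)) μ) {A : Set X}
    (hA : MeasurableSet A) : Differentiable ℝ fun η => (μ.tilted fun x => T x η).real A := by
  have hprob : ∀ η, (μ.tilted fun x => T x η).real A =
      (∫ x in A, Real.exp (T x η) ∂μ) / ∫ x, Real.exp (T x η) ∂μ := fun η => by
    rw [Measure.real, tilted_apply_eq_ofReal_integral' _ hA, integral_div, ENNReal.toReal_ofReal]
    positivity
  have hnum : Differentiable ℝ fun η => ∫ x in A, Real.exp (T x η) ∂μ :=
    differentiable_integral_exp_apply hT.restrict fun c => (hexp c).restrict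
  have hpos : ∀ η, 0 < ∫ x, Real.exp (T x η) ∂μ := fun η =>
    integral_exp_pos (integrable_exp_apply hT hexp η)
  simp only [hprob, div_eq_mul_inv]
  exact hnum.fun_mul <|
    (differentiable_integral_exp_apply hT hexp).fun_inv fun η => (hpos η).ne'

theorem memLp_apply_tilted (hT : AEStronglyMeasurable T μ)
    (hexp : ∀ c : ℝ, Integrable (fun x => Real.exp (c * ‖T x‖)) μ) (η e : E) (q : NNReal) :
    MemLp (fun x => T x e) q (μ.tilted fun x => T x η) := by
  refine memLp_of_mem_interior_integrableExpSet ?_ q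
  have huniv : integrableExpSet (fun x => T x e) (μ.tilted fun x => T x η) = Set.univ := by
    refine Set.eq_univ_of_forall fun t => ?_
    refine (integrable_tilted_iff (integrable_exp_apply hT hexp η) _).2 ?_
    simpa [Real.exp_add] using integrable_exp_apply hT hexp (η + t • e)
  simp [huniv]

variable {ι : Type*}

theorem isLikelihood_tilted [SigmaFinite μ] (hT : StronglyMeasurable T) (η : (ι → ℝ) → E) :
    IsLikelihood (fun θ' => μ.tilted fun x => T x (η θ')) μ
      fun θ' x => Real.exp (T x (η θ')) / ∫ x, Real.exp (T x (η θ')) ∂μ where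
  sigmaFinite := inferInstance
  measurable θ' :=
    have h_apply : StronglyMeasurable fun x => T x (η θ') :=
      (ContinuousLinearMap.apply ℝ ℝ (η θ')).continuous.comp_stronglyMeasurable hT
    (Real.measurable_exp.comp h_apply.measurable).div_const _
  nonneg θ' x := by positivity
  eq_withDensity _ := rfl

variable [DecidableEq ι] {η : (ι → ℝ) → E} {θ : ι → ℝ}

theorem eventwiseDifferentiableAt_tilted [NeZero μ] (hT : AEStronglyMeasurable T μ)
    (hexp : ∀ c : ℝ, Integrable (fun x => Real.exp (c * ‖T x‖)) μ)
    (hη : ∀ i, DifferentiableAt ℝ (fun u => η (Function.update θ i u)) (θ i)) :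
    EventwiseDifferentiableAt (fun θ' => μ.tilted fun x => T x (η θ')) θ := fun i _A hA =>
  (differentiable_measureReal_tilted hT hexp hA _).comp (θ i) (hη i)

theorem hasFisherInformation_tilted [NeZero μ] (hT : StronglyMeasurable T)
    (hexp : ∀ c : ℝ, Integrable (fun x => Real.exp (c * ‖T x‖)) μ)
    (hη : ∀ i, DifferentiableAt ℝ (fun u => η (Function.update θ i u)) (θ i)) :
    HasFisherInformation (fun θ' => μ.tilted fun x => T x (η θ')) θ := by
  have : IsFiniteMeasure μ := by simpa [integrable_const_iff] using hexp 0
  let Z : E → ℝ := fun η => ∫ x, Real.exp (T x η) ∂μ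
  have hZ : ∀ η, Z η ≠ 0 := fun η =>
    (integral_exp_pos (integrable_exp_apply hT.aestronglyMeasurable hexp η)).ne'
  have := isProbabilityMeasure_tilted (integrable_exp_apply hT.aestronglyMeasurable hexp (η θ))
  let η' : ι → E := fun i => deriv (fun u => η (Function.update θ i u)) (θ i)
  let Z' : ι → ℝ := fun i => deriv (fun u => Z (η (Function.update θ i u))) (θ i)
  have hη' : ∀ i, HasDerivAt (fun u => η (Function.update θ i u)) (η' i) (θ i) :=
    fun i => (hη i).hasDerivAt
  have hZ' : ∀ i, HasDerivAt (fun u => Z (η (Function.update θ i u))) (Z' i) (θ i) := fun i =>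
    ((differentiable_integral_exp_apply hT.aestronglyMeasurable hexp _).comp (θ i)
      (hη i)).hasDerivAt
  let score : ι → X → ℝ := fun i x => T x (η' i) - Z' i / Z (η θ)
  refine ⟨_, μ, _, fun i x => score i x * (Real.exp (T x (η θ)) / Z (η θ)),
    isLikelihood_tilted hT η, fun i => ae_of_all _ fun x => ?_, fun i => ?_, fun i j => rfl⟩
  · refine ((HasFDerivAt.comp_hasDerivAt (θ i) (T x).hasFDerivAt (hη' i)).exp.div (hZ' i)
      (hZ _)).congr_deriv ?_
    have := hZ (η θ)
    simp only [Function.comp_apply, Function.update_eq_self, score]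
    field_simp
  · have hscore : MemLp (score i) 2 (μ.tilted fun x => T x (η θ)) :=
      (memLp_apply_tilted hT.aestronglyMeasurable hexp (η θ) (η' i) 2).sub (memLp_const _)
    refine hscore.ae_eq (ae_of_all _ fun x => ?_)
    exact (mul_div_cancel_right₀ _ (div_ne_zero (Real.exp_ne_zero _) (hZ _))).symm

end ExponentialFamily

section GaussianVector

variable {κ : Type*} [Fintype κ]

theorem pi_tilted {X : κ → Type*} [∀ k, MeasurableSpace (X k)] (μ : ∀ k, Measure (X k))
    [∀ k, SigmaFinite (μ k)] (f : ∀ k, X k → ℝ) :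
    Measure.pi (fun k => (μ k).tilted (f k)) = (Measure.pi μ).tilted fun x => ∑ k, f k (x k) := by
  refine Measure.pi_eq fun A hA => ?_
  rw [tilted_apply_eq_ofReal_integral' _ (.univ_pi hA), Measure.restrict_pi_pi]
  simp only [Real.exp_sum, ← Finset.prod_div_distrib,
    integral_fintype_prod_eq_prod (μ := μ) fun k x => Real.exp (f k x)]
  rw [integral_fintype_prod_eq_prod fun k x => Real.exp (f k x) / ∫ y, Real.exp (f k y) ∂μ k,
    ENNReal.ofReal_prod_of_nonneg fun k _ => by positivity]
  exact Finset.prod_congr rfl fun k _ => (tilted_apply_eq_ofReal_integral' _ (hA k)).symm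

theorem gaussianReal_eq_tilted (m : ℝ) {v : NNReal} (hv : v ≠ 0) :
    gaussianReal m v = (gaussianReal 0 v).tilted fun x => m / v * x := by
  have hv' : (v : ℝ) ≠ 0 := by exact_mod_cast hv
  have hZ : ∫ x, Real.exp (m / v * x) ∂gaussianReal 0 v = Real.exp (m ^ 2 / (2 * v)) := by
    rw [← mgf, mgf_gaussianReal (by rw [Measure.map_id'])]
    congr 1
    field_simp
    ring
  rw [Measure.tilted, hZ, gaussianReal_of_var_ne_zero _ hv, gaussianReal_of_var_ne_zero _ hv,
    ← withDensity_mul _ (measurable_gaussianPDF 0 v) (by fun_prop)]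
  congr 1
  funext x
  rw [Pi.mul_apply, gaussianPDF, gaussianPDF, ← ENNReal.ofReal_mul (gaussianPDFReal_nonneg _ _ _),
    gaussianPDFReal, gaussianPDFReal, mul_assoc _ (Real.exp _), ← Real.exp_sub, ← Real.exp_add]
  congr 4
  field_simp
  ring

/-- The law of a vector with independent Gaussian entries of means `m k` and variance `v`. -/
noncomputable def gaussianVector (v : NNReal) (m : κ → ℝ) : Measure (κ → ℝ) :=
  Measure.pi fun k => gaussianReal (m k) v

instance (v : NNReal) (m : κ → ℝ) : IsProbabilityMeasure (gaussianVector v m) := by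
  unfold gaussianVector
  infer_instance

theorem gaussianVector_map_add (v : NNReal) (m₀ m : κ → ℝ) :
    (gaussianVector v m₀).map (· + m) = gaussianVector v (m₀ + m) := by
  simp only [gaussianVector, Pi.add_apply, ← gaussianReal_map_add_const]
  exact Measure.pi_map_pi (f := fun k t => t + m k) fun k => by fun_prop

/-- The natural statistic of the Gaussian location family of variance `v`: it pairs an observation
`x` with a mean `m` into `∑ k, x k * m k / v`. -/
noncomputable def gaussianStatistic (v : NNReal) : (κ → ℝ) →L[ℝ] StrongDual ℝ (κ → ℝ) :=
  (v : ℝ)⁻¹ • ∑ k, (ContinuousLinearMap.proj k).smulRight (ContinuousLinearMap.proj k)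

theorem gaussianVector_eq_tilted {v : NNReal} (hv : v ≠ 0) (m : κ → ℝ) :
    gaussianVector v m = (gaussianVector v 0).tilted fun x => gaussianStatistic v x m := by
  have hpair : ∀ x, gaussianStatistic v x m = ∑ k, m k / v * x k := fun x => by
    simp only [gaussianStatistic, smul_apply, sum_apply,
      ContinuousLinearMap.smulRight_apply, ContinuousLinearMap.proj_apply, smul_eq_mul,
      Finset.mul_sum]
    exact Finset.sum_congr rfl fun k _ => by ring
  simp only [hpair, gaussianVector, Pi.zero_apply, ← pi_tilted, ← gaussianReal_eq_tilted _ hv]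

theorem integrable_exp_mul_norm_gaussianVector (v : NNReal) (m : κ → ℝ) (c : ℝ) :
    Integrable (fun x => Real.exp (c * ‖x‖)) (gaussianVector v m) := by
  have hprod : Integrable (fun x : κ → ℝ => ∏ k, Real.exp (|c| * |x k|)) (gaussianVector v m) :=
    Integrable.fintype_prod (f := fun _ t => Real.exp (|c| * |t|)) fun k =>
      integrable_exp_mul_abs (integrable_exp_mul_gaussianReal |c|)
        (integrable_exp_mul_gaussianReal (-|c|))
  refine hprod.mono' (by fun_prop) (ae_of_all _ fun x => ?_)
  rw [Real.norm_eq_abs, Real.abs_exp, ← Real.exp_sum, ← Finset.mul_sum]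
  have hnorm : ‖x‖ ≤ ∑ k, |x k| :=
    (pi_norm_le_iff_of_nonneg (by positivity)).2 fun k =>
      Finset.single_le_sum (f := fun k => |x k|) (fun _ _ => abs_nonneg _) (Finset.mem_univ k)
  gcongr
  exact le_abs_self c

theorem integrable_exp_mul_norm_gaussianStatistic (v : NNReal) (m : κ → ℝ) (c : ℝ) :
    Integrable (fun x => Real.exp (c * ‖gaussianStatistic (κ := κ) v x‖)) (gaussianVector v m) := by
  refine (integrable_exp_mul_norm_gaussianVector v m
    (|c| * ‖gaussianStatistic (κ := κ) v‖)).mono' (by fun_prop) (ae_of_all _ fun x => ?_)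
  rw [Real.norm_eq_abs, Real.abs_exp, mul_assoc]
  gcongr
  · exact le_abs_self c
  · exact (gaussianStatistic v).le_opNorm x

variable {ι : Type*} [DecidableEq ι] {v : NNReal} {m : (ι → ℝ) → κ → ℝ} {θ : ι → ℝ}

theorem hasFisherInformation_gaussianVector (hv : v ≠ 0)
    (hm : ∀ i, DifferentiableAt ℝ (fun u => m (Function.update θ i u)) (θ i)) :
    HasFisherInformation (fun θ' => gaussianVector v (m θ')) θ := by
  simp only [gaussianVector_eq_tilted hv (m _)]
  exact hasFisherInformation_tilted (gaussianStatistic v).continuous.stronglyMeasurable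
    (integrable_exp_mul_norm_gaussianStatistic v 0) hm

theorem eventwiseDifferentiableAt_gaussianVector (hv : v ≠ 0)
    (hm : ∀ i, DifferentiableAt ℝ (fun u => m (Function.update θ i u)) (θ i)) :
    EventwiseDifferentiableAt (fun θ' => gaussianVector v (m θ')) θ := by
  simp only [gaussianVector_eq_tilted hv (m _)]
  exact eventwiseDifferentiableAt_tilted (gaussianStatistic v).continuous.aestronglyMeasurable
    (integrable_exp_mul_norm_gaussianStatistic v 0) hm

end GaussianVector

section RealCoordinates

/-- The real part (`false`) and the imaginary part (`true`) of a complex number. -/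
noncomputable def reImCLM (b : Bool) : ℂ →L[ℝ] ℝ := bif b then Complex.imCLM else Complex.reCLM

theorem reImCLM_apply_eq_re_mul (b : Bool) (z : ℂ) :
    reImCLM b z = ((bif b then -Complex.I else 1) * z).re := by
  cases b <;> simp [reImCLM]

variable {κ : Type*}

/-- The complex vector with given real (`false`) and imaginary (`true`) parts. -/
def ofReIm (x : κ × Bool → ℝ) : κ → ℂ := fun k => ⟨x (k, false), x (k, true)⟩

theorem ofReIm_reImCLM (y : κ → ℂ) : ofReIm (fun k => reImCLM k.2 (y k.1)) = y := rfl

theorem reImCLM_ofReIm (x : κ × Bool → ℝ) (k : κ × Bool) : reImCLM k.2 (ofReIm x k.1) = x k := by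
  obtain ⟨k, _ | _⟩ := k <;> rfl

theorem measurableEmbedding_ofReIm [Countable κ] : MeasurableEmbedding (ofReIm (κ := κ)) := by
  refine Measurable.measurableEmbedding (measurable_pi_lambda _ fun k => ?_) fun x x' h => ?_
  · simp only [ofReIm, Complex.mk_eq_add_mul_I]
    fun_prop
  · funext k
    rw [← reImCLM_ofReIm x, h, reImCLM_ofReIm]

end RealCoordinates

section Noise

variable {Ω : Type*} [MeasurableSpace Ω] {P : Measure Ω} {B N : ℝ} {n : ℝ → Ω → ℂ}

theorem integral_re_mul_re {U V : Ω → ℂ} (hU : MemLp U 2 P) (hV : MemLp V 2 P) :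
    ∫ ω, (U ω).re * (V ω).re ∂P =
      ((∫ ω, U ω * (starRingEnd ℂ) (V ω) ∂P) + ∫ ω, U ω * V ω ∂P).re / 2 := by
  have hUV_conj : Integrable (fun ω => U ω * (starRingEnd ℂ) (V ω)) P := hU.integrable_mul hV.star
  have hUV : Integrable (fun ω => U ω * V ω) P := hU.integrable_mul hV
  have hsum : Integrable (fun ω => U ω * (starRingEnd ℂ) (V ω) + U ω * V ω) P := hUV_conj.add hUV
  rw [← integral_add hUV_conj hUV, ← Complex.reCLM_apply, ← Complex.reCLM.integral_comp_comm hsum,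
    ← integral_div]
  refine integral_congr_ae (ae_of_all _ fun ω => ?_)
  simp only [Complex.reCLM_apply, Complex.add_re, Complex.mul_re, Complex.conj_re, Complex.conj_im]
  ring

theorem IsFilteredNoise.integral_reImCLM_mul_reImCLM (hn : IsFilteredNoise P B N n) (t₁ t₂ : ℝ)
    (b₁ b₂ : Bool) : ∫ ω, reImCLM b₁ (n t₁ ω) * reImCLM b₂ (n t₂ ω) ∂P =
      if b₁ = b₂ then B * N * nsinc (2 * B * (t₁ - t₂)) else 0 := by
  have hL2 : ∀ (c : ℂ) t, MemLp (fun ω => c * n t ω) 2 P := fun c t =>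
    (hn.isGaussianProcess.hasGaussianLaw_eval t).memLp_two.const_mul c
  simp only [reImCLM_apply_eq_re_mul]
  rw [integral_re_mul_re (hL2 _ _) (hL2 _ _)]
  simp only [map_mul, mul_mul_mul_comm _ (n t₁ _), integral_const_mul, hn.autocorrelation,
    hn.circular, mul_zero, add_zero]
  cases b₁ <;> cases b₂ <;> simp <;> ring

/-- The real and imaginary parts of the noise in the Nyquist samples. -/
noncomputable def nyquistNoise (n : ℝ → Ω → ℂ) (B : ℝ) (K : ℕ) (ω : Ω) : Fin K × Bool → ℝ :=
  fun k => reImCLM k.2 (n (nyquistTime B k.1) ω)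

variable {K : ℕ}

theorem IsFilteredNoise.hasGaussianLaw_nyquistNoise (hn : IsFilteredNoise P B N n) :
    HasGaussianLaw (nyquistNoise n B K) P := by
  let I : Finset ℝ := Finset.univ.image (nyquistTime B (K := K))
  let restrict (p : Fin K) : (I → ℂ) →L[ℝ] ℂ := ContinuousLinearMap.proj
    (⟨nyquistTime B p, Finset.mem_image_of_mem _ (Finset.mem_univ p)⟩ : I)
  exact (hn.isGaussianProcess.hasGaussianLaw I).map
    (ContinuousLinearMap.pi fun k : Fin K × Bool => reImCLM k.2 ∘L restrict k.1)

theorem IsFilteredNoise.integral_nyquistNoise (hn : IsFilteredNoise P B N n) (k : Fin K × Bool) :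
    ∫ ω, nyquistNoise n B K ω k ∂P = 0 := by
  simp only [nyquistNoise]
  rw [(reImCLM k.2).integral_comp_comm (hn.isGaussianProcess.hasGaussianLaw_eval _).integrable,
    hn.mean_zero, map_zero]

theorem nsinc_natCast_sub_natCast (p q : ℕ) : nsinc ((p : ℝ) - q) = if p = q then 1 else 0 := by
  split_ifs with hpq
  · simp [nsinc, hpq]
  · have hne : Real.pi * ((p : ℝ) - q) ≠ 0 :=
      mul_ne_zero Real.pi_ne_zero (sub_ne_zero.2 (Nat.cast_injective.ne hpq))
    have hsin : Real.sin (Real.pi * ((p : ℝ) - q)) = 0 := by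
      rw [mul_comm]
      exact_mod_cast Real.sin_int_mul_pi (p - q)
    rw [nsinc, Real.sinc_of_ne_zero hne, hsin, zero_div]

theorem IsFilteredNoise.covariance_nyquistNoise (hn : IsFilteredNoise P B N n) (hB : B ≠ 0)
    (k l : Fin K × Bool) :
    cov[fun ω => nyquistNoise n B K ω k, fun ω => nyquistNoise n B K ω l; P] =
      if k = l then B * N else 0 := by
  have := hn.isGaussianProcess.isProbabilityMeasure
  have hlag : 2 * B * (nyquistTime B k.1 - nyquistTime B l.1) = (k.1 : ℝ) - (l.1 : ℝ) := by
    simp only [nyquistTime]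
    field_simp
  have hG : ∀ k, HasGaussianLaw (fun ω => nyquistNoise n B K ω k) P :=
    hn.hasGaussianLaw_nyquistNoise.eval
  rw [covariance_eq_sub (hG k).memLp_two (hG l).memLp_two, hn.integral_nyquistNoise, zero_mul,
    sub_zero]
  refine (hn.integral_reImCLM_mul_reImCLM _ _ _ _).trans ?_
  rw [hlag, nsinc_natCast_sub_natCast, mul_ite, mul_one, mul_zero, ← ite_and]
  simp only [Prod.ext_iff, Fin.ext_iff, and_comm]

theorem IsFilteredNoise.map_nyquistNoise (hn : IsFilteredNoise P B N n) (hB : B ≠ 0) :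
    P.map (nyquistNoise n B K) = gaussianVector (B * N).toNNReal 0 := by
  have hG : ∀ k, HasGaussianLaw (fun ω => nyquistNoise n B K ω k) P :=
    hn.hasGaussianLaw_nyquistNoise.eval
  have hindep : iIndepFun (fun k ω => nyquistNoise n B K ω k) P :=
    hn.hasGaussianLaw_nyquistNoise.iIndepFun_of_covariance_eq_zero fun k l hkl => by
      rw [hn.covariance_nyquistNoise hB, if_neg hkl]
  refine (hindep.map_fun_eq_pi_map fun k => (hG k).aemeasurable).trans (congrArg _ ?_)
  funext k
  rw [(hG k).map_eq_gaussianReal, hn.integral_nyquistNoise, ← covariance_self (hG k).aemeasurable,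
    hn.covariance_nyquistNoise hB, if_pos rfl, Pi.zero_apply]

end Noise

section NyquistSamples

/-- The real and imaginary parts of the noiseless Nyquist samples. -/
noncomputable def nyquistMean (s : ℝ → ℂ) (B : ℝ) (K : ℕ) (θ : Fin 6 → ℝ) : Fin K × Bool → ℝ :=
  fun k => reImCLM k.2 ((⟨θ 2, θ 3⟩ : ℂ) * s (nyquistTime B k.1 - θ 0) +
    (⟨θ 4, θ 5⟩ : ℂ) * s (nyquistTime B k.1 - θ 1))

theorem differentiableAt_nyquistMean {s : ℝ → ℂ} {B : ℝ} {K : ℕ} {θ : Fin 6 → ℝ}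
    (hs : ∀ p : Fin K, DifferentiableAt ℝ s (nyquistTime B p - θ 0) ∧
      DifferentiableAt ℝ s (nyquistTime B p - θ 1)) :
    DifferentiableAt ℝ (nyquistMean s B K) θ := by
  have hattenuation : ∀ i j, DifferentiableAt ℝ (fun θ : Fin 6 → ℝ => (⟨θ i, θ j⟩ : ℂ)) θ :=
    fun i j => by
      simp only [Complex.mk_eq_add_mul_I]
      fun_prop
  have hdelay : ∀ t i, DifferentiableAt ℝ s (t - θ i) →
      DifferentiableAt ℝ (fun θ : Fin 6 → ℝ => s (t - θ i)) θ := fun t i hs =>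
    hs.comp θ (by fun_prop)
  refine differentiableAt_pi.2 fun k => (reImCLM k.2).differentiableAt.comp θ ?_
  exact ((hattenuation 2 3).mul (hdelay _ 0 (hs k.1).1)).add
    ((hattenuation 4 5).mul (hdelay _ 1 (hs k.1).2))

theorem nyquistSamples_eq_ofReIm {Ω : Type*} (s : ℝ → ℂ) (n : ℝ → Ω → ℂ) (B : ℝ) (K : ℕ)
    (θ : Fin 6 → ℝ) (ω : Ω) :
    nyquistSamples s n B K θ ω = ofReIm (nyquistNoise n B K ω + nyquistMean s B K θ) := by
  rw [← ofReIm_reImCLM (nyquistSamples s n B K θ ω)]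
  congr 1
  funext k
  simp only [nyquistSamples, received, nyquistNoise, nyquistMean, Pi.add_apply]
  rw [map_add, add_comm]

variable {Ω : Type*} [MeasurableSpace Ω] {P : Measure Ω} {B N : ℝ} {n : ℝ → Ω → ℂ} {s : ℝ → ℂ}
  {K : ℕ} {θ : Fin 6 → ℝ}

theorem IsFilteredNoise.aemeasurable_nyquistSamples (hn : IsFilteredNoise P B N n) :
    AEMeasurable (nyquistSamples s n B K θ) P :=
  aemeasurable_pi_lambda _ fun _ => (hn.isGaussianProcess.aemeasurable _).const_add _

theorem IsFilteredNoise.map_nyquistSamples (hn : IsFilteredNoise P B N n) (hB : B ≠ 0) :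
    P.map (nyquistSamples s n B K θ) =
      (gaussianVector (B * N).toNNReal (nyquistMean s B K θ)).map ofReIm := by
  rw [← zero_add (nyquistMean s B K θ), ← gaussianVector_map_add, ← hn.map_nyquistNoise hB,
    Measure.map_map measurableEmbedding_ofReIm.measurable (by fun_prop),
    AEMeasurable.map_map_of_aemeasurable
      (measurableEmbedding_ofReIm.measurable.comp (by fun_prop)).aemeasurable
      hn.hasGaussianLaw_nyquistNoise.aemeasurable]
  exact congrArg (P.map ·) (funext (nyquistSamples_eq_ofReIm s n B K θ))

theorem differentiableAt_nyquistMean_update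
    (hs : ∀ p : Fin K, DifferentiableAt ℝ s (nyquistTime B p - θ 0) ∧
      DifferentiableAt ℝ s (nyquistTime B p - θ 1)) (i : Fin 6) :
    DifferentiableAt ℝ (fun u => nyquistMean s B K (Function.update θ i u)) (θ i) := by
  refine DifferentiableAt.comp (θ i) (g := nyquistMean s B K) ?_
    (hasDerivAt_update θ i (θ i)).differentiableAt
  rw [Function.update_eq_self]
  exact differentiableAt_nyquistMean hs

theorem IsFilteredNoise.hasFisherInformation_map_nyquistSamples (hn : IsFilteredNoise P B N n)
    (hB : 0 < B) (hN : 0 < N)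
    (hs : ∀ p : Fin K, DifferentiableAt ℝ s (nyquistTime B p - θ 0) ∧
      DifferentiableAt ℝ s (nyquistTime B p - θ 1)) :
    HasFisherInformation (fun θ' => P.map (nyquistSamples s n B K θ')) θ := by
  simp only [hn.map_nyquistSamples hB.ne']
  exact (hasFisherInformation_gaussianVector (Real.toNNReal_pos.2 (mul_pos hB hN)).ne'
    (differentiableAt_nyquistMean_update hs)).map_of_measurableEmbedding measurableEmbedding_ofReIm

theorem IsFilteredNoise.eventwiseDifferentiableAt_map_nyquistSamples (hn : IsFilteredNoise P B N n)
    (hB : 0 < B) (hN : 0 < N)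
    (hs : ∀ p : Fin K, DifferentiableAt ℝ s (nyquistTime B p - θ 0) ∧
      DifferentiableAt ℝ s (nyquistTime B p - θ 1)) :
    EventwiseDifferentiableAt (fun θ' => P.map (nyquistSamples s n B K θ')) θ := by
  simp only [hn.map_nyquistSamples hB.ne']
  exact (eventwiseDifferentiableAt_gaussianVector (Real.toNNReal_pos.2 (mul_pos hB hN)).ne'
    (differentiableAt_nyquistMean_update hs)).map measurableEmbedding_ofReIm.measurable

end NyquistSamples

section Oversampling

variable {r K : ℕ}

theorem oversample_nyquistIndex (hr : 1 ≤ r) (y : Fin K → ℂ) (p : Fin K) :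
    oversample r y (nyquistIndex hr p) = y p := by
  have hr₀ : (r : ℝ) ≠ 0 := by positivity
  simp only [oversample, nyquistIndex, Nat.cast_mul, mul_div_cancel_left₀ _ hr₀,
    nsinc_natCast_sub_natCast, Fin.val_inj]
  simp [apply_ite Complex.ofReal]

theorem measurableEmbedding_oversample (hr : 1 ≤ r) :
    MeasurableEmbedding (oversample r (K := K)) := by
  refine Measurable.measurableEmbedding (by unfold oversample; fun_prop) fun y y' h => ?_
  funext p
  rw [← oversample_nyquistIndex hr y, h, oversample_nyquistIndex]

end Oversampling

section Quantization

variable {L : ℕ}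

theorem measurable_sgn : Measurable sgn :=
  Measurable.ite measurableSet_Ici measurable_const measurable_const

theorem measurable_quantize (γ : Fin L → ℂ) : Measurable (quantize γ) := by
  have hsgn := measurable_sgn
  unfold quantize
  fun_prop

theorem finite_range_quantize (γ : Fin L → ℂ) : (Set.range (quantize γ)).Finite := by
  have hsgn : (Set.range sgn).Finite :=
    (Set.toFinite {1, -1}).subset <| by
      rintro _ ⟨x, rfl⟩
      unfold sgn
      split_ifs <;> simp
  refine (Set.Finite.pi' fun _ : Fin L => hsgn.image2 (fun a b : ℝ =>
    ((1 / Real.sqrt 2 * a : ℝ) : ℂ) + Complex.I * ((1 / Real.sqrt 2 * b : ℝ) : ℂ)) hsgn).subset ?_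
  rintro _ ⟨y, rfl⟩ l
  exact ⟨_, ⟨_, rfl⟩, _, ⟨_, rfl⟩, rfl⟩

theorem quantize_oversample_nyquistIndex {r K : ℕ} (hr : 1 ≤ r) (γ : Fin (r * K) → ℂ)
    (y : Fin K → ℂ) (p : Fin K) : quantize γ (oversample r y) (nyquistIndex hr p) =
      quantize (fun p => γ (nyquistIndex hr p)) y p := by
  simp only [quantize, oversample_nyquistIndex]

theorem ae_mem_toFinset_map_quantize (μ : Measure (Fin L → ℂ)) (γ : Fin L → ℂ) :
    ∀ᵐ z ∂μ.map (quantize γ), z ∈ (finite_range_quantize γ).toFinset := by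
  simp only [Set.Finite.mem_toFinset]
  exact ae_map_mem_range _ (finite_range_quantize γ).measurableSet _

variable {ι : Type*} [DecidableEq ι] {θ : ι → ℝ}

theorem EventwiseDifferentiableAt.hasFisherInformation_map_quantize
    {Q : (ι → ℝ) → Measure (Fin L → ℂ)} [∀ θ', IsFiniteMeasure (Q θ')]
    (hQ : EventwiseDifferentiableAt Q θ) (γ : Fin L → ℂ) :
    HasFisherInformation (fun θ' => (Q θ').map (quantize γ)) θ :=
  (hQ.map (measurable_quantize γ)).hasFisherInformation fun _ => ae_mem_toFinset_map_quantize _ γ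

theorem EventwiseDifferentiableAt.posSemidef_fisherInformation_map_quantize_oversample_sub
    [Finite ι] {r K : ℕ} {Q : (ι → ℝ) → Measure (Fin K → ℂ)} [∀ θ', IsFiniteMeasure (Q θ')]
    (hQ : EventwiseDifferentiableAt Q θ) (hr : 1 ≤ r) (γ : Fin (r * K) → ℂ) :
    (fisherInformation (fun θ' => ((Q θ').map (oversample r)).map (quantize γ)) θ -
      fisherInformation (fun θ' => (Q θ').map (quantize fun p => γ (nyquistIndex hr p)))
        θ).PosSemidef := by
  have hover := (measurableEmbedding_oversample (K := K) hr).measurable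
  have hselect : Measurable fun (z : Fin (r * K) → ℂ) p => z (nyquistIndex hr p) := by fun_prop
  have hnyquist : ∀ θ', (Q θ').map (quantize fun p => γ (nyquistIndex hr p)) =
      (((Q θ').map (oversample r)).map (quantize γ)).map
        fun z p => z (nyquistIndex hr p) := fun θ' => by
    rw [Measure.map_map hselect (measurable_quantize γ),
      Measure.map_map (hselect.comp (measurable_quantize γ)) hover]
    simp only [Function.comp_def, quantize_oversample_nyquistIndex]
  simp only [hnyquist]
  exact ((hQ.map hover).map (measurable_quantize γ)).posSemidef_fisherInformation_sub_map
    (fun _ => ae_mem_toFinset_map_quantize _ γ) hselect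

end Quantization

end OneBit

theorem mainTheorem4 {Ω : Type*} [MeasurableSpace Ω] (P : Measure Ω) [IsProbabilityMeasure P]
    -- bandwidth, noise power, transmitted signal, filtered noise
    (B N : ℝ) (hB : 0 < B) (hN : 0 < N) (s : ℝ → ℂ) (n : ℝ → Ω → ℂ)
    (hn : OneBit.IsFilteredNoise P B N n)
    -- number of Nyquist samples, oversampling factor, thresholds of the one-bit quantizer
    (K r : ℕ) (hr : 1 ≤ r) (γ : Fin (r * K) → ℂ)
    -- the value of the parameter vector at which Fisher information is taken
    (θ : Fin 6 → ℝ)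
    (hs : ∀ p : Fin K, DifferentiableAt ℝ s (OneBit.nyquistTime B p - θ 0) ∧
      DifferentiableAt ℝ s (OneBit.nyquistTime B p - θ 1)) :
    -- Nyquist-rate and oversampled data, in full precision and quantized to one bit
    let yNyq : (Fin 6 → ℝ) → Ω → Fin K → ℂ := OneBit.nyquistSamples s n B K
    let y : (Fin 6 → ℝ) → Ω → Fin (r * K) → ℂ := fun θ' ω => OneBit.oversample r (yNyq θ' ω)
    let zNyq : (Fin 6 → ℝ) → Ω → Fin K → ℂ :=
      fun θ' ω => OneBit.quantize (fun p => γ (OneBit.nyquistIndex hr p)) (yNyq θ' ω)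
    let z : (Fin 6 → ℝ) → Ω → Fin (r * K) → ℂ := fun θ' ω => OneBit.quantize γ (y θ' ω)
    -- the Fisher information matrices of all four observations exist
    (OneBit.HasFisherInformation (fun θ' => P.map (y θ')) θ ∧
      OneBit.HasFisherInformation (fun θ' => P.map (yNyq θ')) θ ∧
      OneBit.HasFisherInformation (fun θ' => P.map (z θ')) θ ∧
      OneBit.HasFisherInformation (fun θ' => P.map (zNyq θ')) θ) ∧
    OneBit.fisherInformation (fun θ' => P.map (y θ')) θ =
      OneBit.fisherInformation (fun θ' => P.map (yNyq θ')) θ ∧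
    (OneBit.fisherInformation (fun θ' => P.map (z θ')) θ -
      OneBit.fisherInformation (fun θ' => P.map (zNyq θ')) θ).PosSemidef := by
  intro yNyq y zNyq z
  let Q : (Fin 6 → ℝ) → Measure (Fin K → ℂ) := fun θ' => P.map (yNyq θ')
  have hQ_fisher : OneBit.HasFisherInformation Q θ :=
    hn.hasFisherInformation_map_nyquistSamples hB hN hs
  have hQ_diff : OneBit.EventwiseDifferentiableAt Q θ :=
    hn.eventwiseDifferentiableAt_map_nyquistSamples hB hN hs
  have hover := OneBit.measurableEmbedding_oversample (K := K) hr
  have hlaw : ∀ {X : Type} [MeasurableSpace X] {T : (Fin K → ℂ) → X}, Measurable T →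
      ∀ θ', P.map (fun ω => T (yNyq θ' ω)) = (Q θ').map T := fun hT _ =>
    (AEMeasurable.map_map_of_aemeasurable hT.aemeasurable hn.aemeasurable_nyquistSamples).symm
  have hy : ∀ θ', P.map (y θ') = (Q θ').map (OneBit.oversample r) := hlaw hover.measurable
  have hzNyq : ∀ θ', P.map (zNyq θ') = (Q θ').map (OneBit.quantize _) :=
    hlaw (OneBit.measurable_quantize _)
  have hz : ∀ θ', P.map (z θ') = ((Q θ').map (OneBit.oversample r)).map (OneBit.quantize γ) :=
    fun θ' => (hlaw ((OneBit.measurable_quantize γ).comp hover.measurable) θ').trans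
      (Measure.map_map (OneBit.measurable_quantize γ) hover.measurable).symm
  simp only [hy, hz, hzNyq]
  exact ⟨⟨hQ_fisher.map_of_measurableEmbedding hover, hQ_fisher,
      (hQ_diff.map hover.measurable).hasFisherInformation_map_quantize γ,
      hQ_diff.hasFisherInformation_map_quantize _⟩,
    hQ_fisher.fisherInformation_map_of_measurableEmbedding hover,
    hQ_diff.posSemidef_fisherInformation_map_quantize_oversample_sub hr γ⟩
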